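/- **Theorem.** Let $p$ be a prime and let $R$ be an $F$-finite, strongly $F$-regular domain of characteristic $p$. That is, the Frobenius map of $R$ is module-finite, and for every nonzero $c\in R$ there is $e\ge 0$ such that the $R$-linear map $R\to F^e_*R$, $1\mapsto F^e_*c$, splits. Let $D_R=\bigcup_{e\ge 0}D_R^{(e)}$, where $D^{(e)}_R=\operatorname{End}_{R^{p^e}}(R)$, be the ring of ($\mathbb F_p$-linear) differential operators on $R$. Let $f\in R$ be a nonzerodivisor. For $e\ge 0$ let $$\mathcal B_f(p^e)=\{\,n\in\mathbb Z_{\ge 0} : D^{(e)}_R\cdot f^{n+1}R\subsetneq D^{(e)}_R\cdot f^nR\,\}$$ be the set of differential jumps of level $e$ of $f$. Assume that $f$ is Bernstein–Sato admissible, i.e. that the ideal $fR$ is generated by some $r$ elements such that the cardinality of $\mathcal B_f(p^e)\cap[0,rp^e)$ is bounded independently of $e$. Let $\alpha\in\mathbb Q$ have denominator prime to $p$ and satisfy $-1\le\alpha<0$; view $\alpha$ also as a $p$-adic integer. Let $R_f\boldsymbol{f^\alpha}$ be the $D_R$-module whose elements are $g\boldsymbol{f^\alpha}$ with $g\in R_f$,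 on which $\delta\in D_R^{(e)}$ acts by $$\delta\cdot(g\boldsymbol{f^\alpha})=f^{-a}\,\delta(f^a g)\,\boldsymbol{f^\alpha},$$ where $a$ is any nonnegative integer with $a\equiv\alpha \pmod{p^e}$ and $\delta$ is extended $R_f^{p^e}$-linearly to $R_f$. The following are equivalent: (a) $R_f\boldsymbol{f^\alpha}$ is not a simple $D_R$-module; (b) $\alpha$ is a Bernstein–Sato root of $f$, i.e. $\alpha$ is the $p$-adic limit of a sequence $(\nu_e)_{e\ge 0}$ with $\nu_e\in\mathcal B_f(p^e)$ for all $e$; (c) $-\alpha$ is a differential threshold of $f$, i.e. $-\alpha=\lim_{e\to\infty}\nu_e/p^e$ in $\mathbb R$ for some sequence $(\nu_e)_{e\ge 0}$ with $\nu_e\in\mathcal B_f(p^e)$ for all $e$. -/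

import Mathlib

open Filter Topology

noncomputable section

namespace BSRoot

/-! ### Differential operators -/

/-- The ring `D_R^{(e)} = End_{R^{p^e}}(R)` of differential operators of level `e`. -/
def diffOpLevel (p : ℕ) (R : Type*) [CommRing R] (e : ℕ) : Subring (AddMonoid.End R) where
  carrier := {δ | ∀ r x : R, δ (r ^ p ^ e * x) = r ^ p ^ e * δ x}
  mul_mem' {a b} ha hb r x := by
    show a (b (r ^ p ^ e * x)) = r ^ p ^ e * a (b x)
    rw [hb, ha]
  one_mem' r x := rfl
  add_mem' {a b} ha hb r x := by
    show a (r ^ p ^ e * x) + b (r ^ p ^ e * x) = r ^ p ^ e * (a x + b x)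
    rw [ha, hb, mul_add]
  zero_mem' r x := (mul_zero _).symm
  neg_mem' {a} ha r x := by
    show -(a (r ^ p ^ e * x)) = r ^ p ^ e * -(a x)
    rw [ha, mul_neg]

theorem diffOpLevel_mono (p : ℕ) (R : Type*) [CommRing R] {e e' : ℕ} (h : e ≤ e') :
    diffOpLevel p R e ≤ diffOpLevel p R e' := by
  intro δ hδ r x
  obtain ⟨k, rfl⟩ := Nat.exists_eq_add_of_le h
  have : r ^ p ^ (e + k) = (r ^ p ^ k) ^ p ^ e := by
    rw [← pow_mul, ← pow_add, add_comm]
  rw [this]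
  exact hδ _ _

/-- The ring `D_R = ⋃ₑ D_R^{(e)}` of differential operators on `R`. It is the ring of
Grothendieck differential operators, see `mem_diffOp_iff` below. -/
def diffOp (p : ℕ) (R : Type*) [CommRing R] : Subring (AddMonoid.End R) where
  carrier := {δ | ∃ e, δ ∈ diffOpLevel p R e}
  mul_mem' := by
    rintro a b ⟨e, ha⟩ ⟨e', hb⟩
    exact ⟨max e e', mul_mem (diffOpLevel_mono p R (le_max_left _ _) ha)
      (diffOpLevel_mono p R (le_max_right _ _) hb)⟩
  one_mem' := ⟨0, one_mem _⟩
  add_mem' := by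
    rintro a b ⟨e, ha⟩ ⟨e', hb⟩
    exact ⟨max e e', add_mem (diffOpLevel_mono p R (le_max_left _ _) ha)
      (diffOpLevel_mono p R (le_max_right _ _) hb)⟩
  zero_mem' := ⟨0, zero_mem _⟩
  neg_mem' := by
    rintro a ⟨e, ha⟩
    exact ⟨e, neg_mem ha⟩

theorem exists_common_level {p : ℕ} {R : Type*} [CommRing R] (δ δ' : diffOp p R) : ∃ e,
    (δ : AddMonoid.End R) ∈ diffOpLevel p R e ∧ (δ' : AddMonoid.End R) ∈ diffOpLevel p R e := by
  obtain ⟨e, he⟩ := δ.2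
  obtain ⟨e', he'⟩ := δ'.2
  exact ⟨max e e', diffOpLevel_mono p R (le_max_left _ _) he,
    diffOpLevel_mono p R (le_max_right _ _) he'⟩

/-- A ring of characteristic `p` is `F`-finite if the Frobenius is module-finite. -/
def FFinite (p : ℕ) (R : Type*) [CommRing R] [Fact p.Prime] [CharP R p] : Prop :=
  (frobenius R p).Finite

/-- Multiplication by `r`, as an additive endomorphism. -/
def mulOp {R : Type*} [CommRing R] (r : R) : AddMonoid.End R := AddMonoidHom.mulLeft r

/-- Grothendieck's inductive definition of an (additive) differential operator of order at
most `n`. In characteristic `p`, additive maps are the same as `𝔽_p`-linear maps. -/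
def HasOrderLE {R : Type*} [CommRing R] : ℕ → AddMonoid.End R → Prop
  | 0, δ => ∀ r x : R, δ (r * x) = r * δ x
  | n + 1, δ => ∀ r : R,
      HasOrderLE n (δ * mulOp r - mulOp r * δ)

section comparison

variable {p : ℕ} {R : Type*} [CommRing R]

theorem HasOrderLE.ad_pow {r : R} {n : ℕ} {δ : AddMonoid.End R} (h : HasOrderLE n δ)
    (T : AddMonoid.End (AddMonoid.End R))
    (hT : ∀ δ, T δ = δ * mulOp r - mulOp r * δ) :
    (T ^ (n + 1)) δ = 0 := by
  induction n generalizing δ with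
  | zero =>
    rw [zero_add, pow_one, hT]
    ext x
    show δ (r * x) - r * δ x = 0
    rw [h r x, sub_self]
  | succ n ih =>
    rw [pow_succ]
    show (T ^ (n + 1)) (T δ) = 0
    rw [hT]
    exact ih (h r)

theorem HasOrderLE.mem_diffOp [hp : Fact p.Prime] [CharP R p] {n : ℕ} {δ : AddMonoid.End R}
    (h : HasOrderLE n δ) : δ ∈ diffOp p R := by
  refine ⟨n + 1, fun r x => ?_⟩
  let m : AddMonoid.End R := mulOp r
  let A : AddMonoid.End (AddMonoid.End R) := AddMonoidHom.mulLeft m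
  let B : AddMonoid.End (AddMonoid.End R) := AddMonoidHom.mulRight m
  let T : AddMonoid.End (AddMonoid.End R) := B - A
  have hT : T + A = B := by
    ext δ x
    show δ (r * x) - r * δ x + r * δ x = δ (r * x)
    ring
  have hc : Commute T A := by
    ext δ x
    show r * δ (r * x) - r * (r * δ x) = r * (δ (r * x) - r * δ x)
    ring
  obtain ⟨z, hz⟩ := hc.exists_add_pow_prime_pow_eq hp.out (n + 1)
  have hsmul : ∀ (k : ℕ) (δ : AddMonoid.End R) (x : R), (k • δ) x = (k : R) * δ x := by
    intro k δ x
    rw [← nsmul_eq_mul]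
    rfl
  have hp0 : ((p : ℕ) : AddMonoid.End (AddMonoid.End R)) = 0 := by
    ext δ x
    rw [AddMonoid.End.natCast_apply, hsmul, CharP.cast_eq_zero, zero_mul]
    rfl
  rw [hp0, zero_mul, zero_mul, zero_mul, add_zero, hT] at hz
  have h0 : (T ^ p ^ (n + 1)) δ = 0 := by
    have hle : n + 1 ≤ p ^ (n + 1) := (Nat.lt_pow_self hp.out.one_lt).le
    rw [← Nat.sub_add_cancel hle, pow_add]
    show (T ^ _) ((T ^ (n + 1)) δ) = 0
    rw [h.ad_pow (r := r) T (fun δ => rfl), map_zero]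
  have hApow : ∀ k : ℕ, ∀ (δ : AddMonoid.End R) (x : R), (A ^ k) δ x = r ^ k * δ x := by
    intro k
    induction k with
    | zero => intro δ x; simp
    | succ k ih =>
      intro δ x
      rw [pow_succ]
      show (A ^ k) (A δ) x = _
      rw [ih]
      show r ^ k * (r * δ x) = _
      ring
  have hBpow : ∀ k : ℕ, ∀ (δ : AddMonoid.End R) (x : R), (B ^ k) δ x = δ (r ^ k * x) := by
    intro k
    induction k with
    | zero => intro δ x; simp
    | succ k ih =>
      intro δ x
      rw [pow_succ]
      show (B ^ k) (B δ) x = _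
      rw [ih]
      show δ (r * (r ^ k * x)) = _
      congr 1
      ring
  rw [← hBpow, ← hApow, hz]
  show (T ^ p ^ (n + 1)) δ x + (A ^ p ^ (n + 1)) δ x = _
  rw [h0]
  simp

theorem finite_iterateFrobenius [Fact p.Prime] [CharP R p] (h : FFinite p R) (e : ℕ) :
    (iterateFrobenius R p e).Finite := by
  induction e with
  | zero =>
    rw [iterateFrobenius_zero]
    exact RingHom.Finite.id R
  | succ e ih =>
    have : iterateFrobenius R p (e + 1) = (iterateFrobenius R p e).comp (frobenius R p) := by
      ext x
      simp [iterateFrobenius_def, frobenius_def, ← pow_mul, pow_succ']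
    rw [this]
    exact ih.comp h

theorem HasOrderLE.of_ideal {S : Type*} [CommRing S] [Algebra S R]
    (F : TensorProduct S R R →ₐ[S] Module.End S (Module.End S R))
    (hF : ∀ (r s : R) (δ : Module.End S R) (x : R), F (r ⊗ₜ s) δ x = r * δ (s * x))
    (n : ℕ) (δ : Module.End S R) (h : ∀ d ∈ KaehlerDifferential.ideal S R ^ (n + 1), F d δ = 0) :
    HasOrderLE n (show AddMonoid.End R from δ.toAddMonoidHom) := by
  have hmem : ∀ r : R, (1 : R) ⊗ₜ[S] r - r ⊗ₜ[S] (1 : R) ∈ KaehlerDifferential.ideal S R :=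
    fun r => KaehlerDifferential.one_smul_sub_smul_one_mem_ideal S r
  induction n generalizing δ with
  | zero =>
    show ∀ r x : R, δ (r * x) = r * δ x
    intro r x
    have := h _ (by rw [zero_add, pow_one]; exact hmem r)
    have := congrArg (fun T : Module.End S R => T x) this
    simp only [map_sub, LinearMap.sub_apply, hF, one_mul, LinearMap.zero_apply] at this
    exact sub_eq_zero.mp this
  | succ n ih =>
    simp only [HasOrderLE]
    intro r
    have key := ih (F ((1 : R) ⊗ₜ[S] r - r ⊗ₜ[S] (1 : R)) δ) (by
      intro d hd
      have := h (d * ((1 : R) ⊗ₜ[S] r - r ⊗ₜ[S] (1 : R))) (by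
        rw [pow_succ]
        exact Ideal.mul_mem_mul hd (hmem r))
      rw [map_mul] at this
      exact this)
    convert key using 1
    ext x
    show δ (r * x) - r * δ x = (F ((1 : R) ⊗ₜ[S] r - r ⊗ₜ[S] (1 : R)) δ) x
    simp only [map_sub, LinearMap.sub_apply, hF, one_mul]

theorem exists_hasOrderLE [hp : Fact p.Prime] [CharP R p] (hR : FFinite p R)
    {δ : AddMonoid.End R} (h : δ ∈ diffOp p R) : ∃ n, HasOrderLE n δ := by
  obtain ⟨e, he⟩ := h
  let S := (iterateFrobenius R p e).range
  have hfin : Module.Finite S R := by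
    have h1 : (S.subtype.comp (iterateFrobenius R p e).rangeRestrict).Finite :=
      finite_iterateFrobenius hR e
    exact RingHom.Finite.of_comp_finite h1
  let lin : Module.End S R :=
    { toFun := δ
      map_add' := map_add δ
      map_smul' := by
        rintro ⟨_, s, rfl⟩ x
        exact he s x }
  let FL : R →ₐ[S] Module.End S (Module.End S R) :=
    AlgHom.ofLinearMap
      { toFun := fun r => LinearMap.mulLeft S (LinearMap.mulLeft S r)
        map_add' := fun a b => by ext; simp [add_mul]
        map_smul' := fun a b => by ext; simp }
      (by ext; simp) (fun a b => by ext; simp)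
  let FR : R →ₐ[S] Module.End S (Module.End S R) :=
    AlgHom.ofLinearMap
      { toFun := fun r => LinearMap.mulRight S (LinearMap.mulLeft S r)
        map_add' := fun a b => by ext; simp [add_mul]
        map_smul' := fun a b => by ext; simp }
      (by ext; simp) (fun a b => by ext; simp [mul_left_comm])
  let F : TensorProduct S R R →ₐ[S] Module.End S (Module.End S R) :=
    Algebra.TensorProduct.lift FL FR (fun a b => by ext δ x; rfl)
  have hF : ∀ (r s : R) (δ : Module.End S R) (x : R), F (r ⊗ₜ s) δ x = r * δ (s * x) := by
    intro r s δ x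
    rfl
  have hnil : IsNilpotent (KaehlerDifferential.ideal S R) := by
    have hfg : (KaehlerDifferential.ideal S R).FG := KaehlerDifferential.ideal_fg S R
    rw [Ideal.FG.isNilpotent_iff_le_nilradical hfg, ← KaehlerDifferential.span_range_eq_ideal,
      Ideal.span_le]
    rintro _ ⟨r, rfl⟩
    refine ⟨p ^ e, ?_⟩
    obtain ⟨z, hz⟩ := exists_add_pow_prime_pow_eq hp.out
      ((1 : R) ⊗ₜ[S] r - r ⊗ₜ[S] (1 : R)) (r ⊗ₜ[S] (1 : R)) e
    have hp0 : ((p : ℕ) : TensorProduct S R R) = 0 := by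
      rw [← map_natCast (algebraMap R (TensorProduct S R R)) p, CharP.cast_eq_zero, map_zero]
    rw [hp0, zero_mul, zero_mul, zero_mul, add_zero, sub_add_cancel,
      Algebra.TensorProduct.tmul_pow, Algebra.TensorProduct.tmul_pow, one_pow] at hz
    have hs : ∀ s : S, (1 : R) ⊗ₜ[S] (s : R) = (s : R) ⊗ₜ[S] (1 : R) := by
      intro s
      have := TensorProduct.smul_tmul (R := S) (R' := S) s (1 : R) (1 : R)
      rw [Algebra.smul_def, mul_one] at this
      exact this.symm
    have := hs ⟨r ^ p ^ e, r, iterateFrobenius_def p e r⟩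
    simp only at this
    rw [this] at hz
    exact left_eq_add.mp (by rwa [add_comm] at hz)
  obtain ⟨N, hN⟩ := hnil
  refine ⟨N, HasOrderLE.of_ideal F hF N lin fun d hd => ?_⟩
  rw [pow_succ, hN, Submodule.zero_eq_bot, Ideal.bot_mul, Ideal.mem_bot] at hd
  rw [hd, map_zero, LinearMap.zero_apply]

/-- On an `F`-finite ring, `diffOp` consists of the Grothendieck differential operators. -/
theorem mem_diffOp_iff [Fact p.Prime] [CharP R p] (hR : FFinite p R) (δ : AddMonoid.End R) :
    δ ∈ diffOp p R ↔ ∃ n, HasOrderLE n δ :=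
  ⟨exists_hasOrderLE hR, fun ⟨_, h⟩ => h.mem_diffOp⟩

end comparison

/-! ### Extending differential operators to a localization -/

section localization

variable {p : ℕ} {R : Type*} [CommRing R]

/-- The extension of an operator `δ` of level `e` to an operator on the localization `M⁻¹R`,
given by `δ (r / s) = δ (s ^ (p ^ e - 1) * r) / s ^ (p ^ e)`. -/
def locExtend [hp : Fact p.Prime] (M : Submonoid R) (e : ℕ) (δ : AddMonoid.End R)
    (hδ : δ ∈ diffOpLevel p R e) : AddMonoid.End (Localization M) where
  toFun x := Localization.liftOn x
    (fun r s => Localization.mk (δ ((s : R) ^ (p ^ e - 1) * r)) (s ^ p ^ e)) (by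
      intro r r' s s' h
      rw [Localization.r_iff_exists] at h
      obtain ⟨c, hc⟩ := h
      rw [Localization.mk_eq_mk_iff, Localization.r_iff_exists]
      refine ⟨c ^ p ^ e, ?_⟩
      have hq : p ^ e = (p ^ e - 1) + 1 :=
        (Nat.sub_add_cancel (Nat.one_le_pow _ _ hp.out.pos)).symm
      simp only [SubmonoidClass.coe_pow]
      rw [← hδ, ← hδ, ← hδ, ← hδ]
      congr 1
      rw [hq]
      simp only [Nat.add_sub_cancel]
      have h2 : (c : R) * s' * r = c * s * r' := by
        rw [mul_assoc, mul_assoc]; exact hc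
      generalize p ^ e - 1 = k
      calc (c : R) ^ (k + 1) * ((s' : R) ^ (k + 1) * ((s : R) ^ k * r))
          = (c : R) ^ k * (s' : R) ^ k * (s : R) ^ k * (c * s' * r) := by ring
        _ = (c : R) ^ k * (s' : R) ^ k * (s : R) ^ k * (c * s * r') := by rw [h2]
        _ = _ := by ring)
  map_zero' := by
    rw [← Localization.mk_zero 1, Localization.liftOn_mk, mul_zero, map_zero,
      Localization.mk_zero, Localization.mk_zero]
  map_add' x y := by
    induction x using Localization.induction_on with | _ x
    induction y using Localization.induction_on with | _ y
    obtain ⟨r, s⟩ := x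
    obtain ⟨r', s'⟩ := y
    have hq : p ^ e = (p ^ e - 1) + 1 :=
      (Nat.sub_add_cancel (Nat.one_le_pow _ _ hp.out.pos)).symm
    simp only [Localization.add_mk, Localization.liftOn_mk]
    congr 1
    · simp only [SubmonoidClass.coe_pow, Submonoid.coe_mul]
      rw [← hδ, ← hδ, ← map_add]
      congr 1
      rw [hq]
      simp only [Nat.add_sub_cancel]
      ring
    · rw [mul_pow]

theorem locExtend_mk [Fact p.Prime] (M : Submonoid R) (e : ℕ) (δ : AddMonoid.End R)
    (hδ : δ ∈ diffOpLevel p R e) (r : R) (s : M) :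
    locExtend M e δ hδ (Localization.mk r s) =
      Localization.mk (δ ((s : R) ^ (p ^ e - 1) * r)) (s ^ p ^ e) := rfl

theorem locExtend_algebraMap [Fact p.Prime] (M : Submonoid R) (e : ℕ) (δ : AddMonoid.End R)
    (hδ : δ ∈ diffOpLevel p R e) (r : R) :
    locExtend M e δ hδ (algebraMap R _ r) = algebraMap R _ (δ r) := by
  rw [← Localization.mk_one_eq_algebraMap, ← Localization.mk_one_eq_algebraMap, locExtend_mk]
  simp

theorem locExtend_mem [hp : Fact p.Prime] (M : Submonoid R) (e : ℕ) (δ : AddMonoid.End R)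
    (hδ : δ ∈ diffOpLevel p R e) : locExtend M e δ hδ ∈ diffOpLevel p (Localization M) e := by
  intro y x
  induction x using Localization.induction_on with | _ x
  induction y using Localization.induction_on with | _ y
  obtain ⟨r, s⟩ := x
  obtain ⟨r', s'⟩ := y
  have hq : p ^ e = (p ^ e - 1) + 1 :=
    (Nat.sub_add_cancel (Nat.one_le_pow _ _ hp.out.pos)).symm
  simp only [Localization.mk_pow, Localization.mk_mul, locExtend_mk]
  rw [← hδ, Localization.mk_eq_mk_iff, Localization.r_iff_exists]
  refine ⟨1, ?_⟩
  simp only [SubmonoidClass.coe_pow, Submonoid.coe_mul, Submonoid.coe_one, one_mul]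
  rw [← mul_pow, ← hδ, ← hδ]
  congr 1
  rw [hq]
  simp only [Nat.add_sub_cancel]
  ring

theorem locExtend_unique [Fact p.Prime] (M : Submonoid R) (e : ℕ)
    {T T' : AddMonoid.End (Localization M)} (hT : T ∈ diffOpLevel p (Localization M) e)
    (hT' : T' ∈ diffOpLevel p (Localization M) e)
    (h : ∀ r : R, T (algebraMap R _ r) = T' (algebraMap R _ r)) : T = T' := by
  ext x
  obtain ⟨⟨r, s⟩, hx⟩ := IsLocalization.surj M x
  have hu : IsUnit (algebraMap R (Localization M) s ^ p ^ e) :=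
    (IsLocalization.map_units (Localization M) s).pow _
  have hpos : p ^ e = (p ^ e - 1) + 1 :=
    (Nat.sub_add_cancel (Nat.one_le_pow _ _ (Fact.out : p.Prime).pos)).symm
  have hs : algebraMap R (Localization M) s ^ p ^ e * x =
      algebraMap R (Localization M) ((s : R) ^ (p ^ e - 1) * r) := by
    rw [map_mul, ← hx, map_pow]
    conv_lhs => rw [hpos, pow_succ]
    ring
  apply hu.mul_left_cancel
  rw [← hT, ← hT', hs, h]

end localization

/-! ### The module `R_f f^α` -/

section twisted

variable {p : ℕ} [hp : Fact p.Prime] {R : Type*} [CommRing R]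

/-- The operator `f⁻ᵃ δ fᵃ` on `R_f`, for `δ` of level `e`. -/
def conj (f : R) (a e : ℕ) (δ : AddMonoid.End R) (hδ : δ ∈ diffOpLevel p R e) :
    AddMonoid.End (Localization.Away f) :=
  mulOp (IsLocalization.Away.invSelf f ^ a) * locExtend (Submonoid.powers f) e δ hδ *
    mulOp (algebraMap R (Localization.Away f) f ^ a)

theorem conj_apply (f : R) (a e : ℕ) (δ : AddMonoid.End R) (hδ : δ ∈ diffOpLevel p R e)
    (x : Localization.Away f) :
    conj f a e δ hδ x = IsLocalization.Away.invSelf f ^ a *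
      locExtend (Submonoid.powers f) e δ hδ (algebraMap R (Localization.Away f) f ^ a * x) := rfl

theorem conj_level (f : R) (a : ℕ) {e e' : ℕ} {δ : AddMonoid.End R}
    (hδ : δ ∈ diffOpLevel p R e) (hδ' : δ ∈ diffOpLevel p R e') :
    conj f a e δ hδ = conj f a e' δ hδ' := by
  have : locExtend (Submonoid.powers f) e δ hδ = locExtend (Submonoid.powers f) e' δ hδ' :=
    locExtend_unique _ (max e e')
      (diffOpLevel_mono p _ (le_max_left _ _) (locExtend_mem _ _ _ _))
      (diffOpLevel_mono p _ (le_max_right _ _) (locExtend_mem _ _ _ _))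
      (fun r => by rw [locExtend_algebraMap, locExtend_algebraMap])
  rw [conj, conj, this]

theorem conj_congr (f : R) {a a' e : ℕ} (h : a ≡ a' [MOD p ^ e]) (δ : AddMonoid.End R)
    (hδ : δ ∈ diffOpLevel p R e) : conj f a e δ hδ = conj f a' e δ hδ := by
  wlog hle : a ≤ a' generalizing a a'
  · exact (this h.symm (le_of_not_ge hle)).symm
  obtain ⟨k, hk⟩ := (Nat.modEq_iff_dvd' hle).mp h
  obtain rfl : a' = a + p ^ e * k := by omega
  have hone := IsLocalization.Away.mul_invSelf (S := Localization.Away f) f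
  ext x
  rw [conj_apply, conj_apply]
  have h1 : algebraMap R (Localization.Away f) f ^ (a + p ^ e * k) * x =
      (algebraMap R (Localization.Away f) f ^ k) ^ p ^ e *
        (algebraMap R (Localization.Away f) f ^ a * x) := by ring
  rw [h1, locExtend_mem (Submonoid.powers f) e δ hδ]
  generalize locExtend (Submonoid.powers f) e δ hδ _ = y
  calc _ = IsLocalization.Away.invSelf f ^ a *
        (algebraMap R (Localization.Away f) f * IsLocalization.Away.invSelf f) ^ (p ^ e * k) * y := by
        rw [hone, one_pow, mul_one]
    _ = _ := by ring

theorem appr_modEq (α : ℤ_[p]) {e a : ℕ} (h : α - a ∈ Ideal.span {(p : ℤ_[p]) ^ e}) :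
    α.appr e ≡ a [MOD p ^ e] := by
  have h1 := sub_mem h (α.appr_spec e)
  have h2 : (((α.appr e : ℤ) - (a : ℤ) : ℤ) : ℤ_[p]) ∈ Ideal.span {(p : ℤ_[p]) ^ e} := by
    convert h1 using 1
    push_cast
    ring
  rw [← PadicInt.norm_le_pow_iff_mem_span_pow, PadicInt.norm_int_le_pow_iff_dvd] at h2
  exact (Nat.modEq_iff_dvd.mpr (by exact_mod_cast h2)).symm

/-- The operator `Υ_α(δ) = f ^ (-α_{<e}) δ f ^ (α_{<e})` on `R_f`, where `δ` has level `e` and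
`α_{<e}` is the `e`-th truncation of the `p`-adic integer `α`. It does not depend on the
level `e` that is used, see `upsilonFun_eq`. -/
def upsilonFun (f : R) (α : ℤ_[p]) (δ : diffOp p R) : AddMonoid.End (Localization.Away f) :=
  conj f (α.appr δ.2.choose) δ.2.choose δ δ.2.choose_spec

theorem upsilonFun_eq (f : R) (α : ℤ_[p]) (δ : diffOp p R) {e a : ℕ}
    (hδ : (δ : AddMonoid.End R) ∈ diffOpLevel p R e)
    (ha : α - a ∈ Ideal.span {(p : ℤ_[p]) ^ e}) :
    upsilonFun f α δ = conj f a e δ hδ := by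
  have key : ∀ e₁ e₂ (h₁ : (δ : AddMonoid.End R) ∈ diffOpLevel p R e₁)
      (h₂ : (δ : AddMonoid.End R) ∈ diffOpLevel p R e₂), e₁ ≤ e₂ →
      conj f (α.appr e₁) e₁ δ h₁ = conj f (α.appr e₂) e₂ δ h₂ := by
    intro e₁ e₂ h₁ h₂ hle
    rw [← conj_level f _ h₁ h₂]
    refine conj_congr f (appr_modEq α ?_) _ _
    refine Ideal.span_singleton_le_span_singleton.mpr ?_ (α.appr_spec e₂)
    exact pow_dvd_pow _ hle
  rw [← conj_congr f (appr_modEq α ha) _ hδ]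
  rcases le_total δ.2.choose e with h | h
  · exact key _ _ _ _ h
  · exact (key _ _ _ _ h).symm

theorem conj_one (f : R) (a e : ℕ) : conj f a e 1 (one_mem (diffOpLevel p R e)) = 1 := by
  have h : locExtend (Submonoid.powers f) e 1 (one_mem (diffOpLevel p R e)) = 1 :=
    locExtend_unique _ e (locExtend_mem _ _ _ _) (one_mem _)
      (fun r => by rw [locExtend_algebraMap]; rfl)
  ext x
  rw [conj_apply, h, AddMonoid.End.coe_one, id, ← mul_assoc, ← mul_pow, mul_comm _ (algebraMap _ _ f),
    IsLocalization.Away.mul_invSelf, one_pow, one_mul]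
  rfl

theorem conj_add (f : R) (a e : ℕ) {δ δ' : AddMonoid.End R} (hδ : δ ∈ diffOpLevel p R e)
    (hδ' : δ' ∈ diffOpLevel p R e) :
    conj f a e (δ + δ') (add_mem hδ hδ') = conj f a e δ hδ + conj f a e δ' hδ' := by
  have h : locExtend (Submonoid.powers f) e (δ + δ') (add_mem hδ hδ') =
      locExtend (Submonoid.powers f) e δ hδ + locExtend (Submonoid.powers f) e δ' hδ' :=
    locExtend_unique _ e (locExtend_mem _ _ _ _)
      (add_mem (locExtend_mem _ _ _ _) (locExtend_mem _ _ _ _)) (fun r => by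
        rw [locExtend_algebraMap]
        show algebraMap R _ (δ r + δ' r) =
          locExtend _ e δ hδ (algebraMap R _ r) + locExtend _ e δ' hδ' (algebraMap R _ r)
        rw [locExtend_algebraMap, locExtend_algebraMap, map_add])
  rw [conj, h, mul_add, add_mul]
  rfl

theorem conj_mul (f : R) (a e : ℕ) {δ δ' : AddMonoid.End R} (hδ : δ ∈ diffOpLevel p R e)
    (hδ' : δ' ∈ diffOpLevel p R e) :
    conj f a e (δ * δ') (mul_mem hδ hδ') = conj f a e δ hδ * conj f a e δ' hδ' := by
  have h : locExtend (Submonoid.powers f) e (δ * δ') (mul_mem hδ hδ') =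
      locExtend (Submonoid.powers f) e δ hδ * locExtend (Submonoid.powers f) e δ' hδ' :=
    locExtend_unique _ e (locExtend_mem _ _ _ _)
      (mul_mem (locExtend_mem _ _ _ _) (locExtend_mem _ _ _ _)) (fun r => by
        rw [locExtend_algebraMap]
        show algebraMap R _ (δ (δ' r)) =
          locExtend _ e δ hδ (locExtend _ e δ' hδ' (algebraMap R _ r))
        rw [locExtend_algebraMap, locExtend_algebraMap])
  ext x
  show _ = conj f a e δ hδ (conj f a e δ' hδ' x)
  rw [conj_apply, conj_apply, conj_apply, h, ← mul_assoc (algebraMap R _ f ^ a), ← mul_pow,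
    IsLocalization.Away.mul_invSelf, one_pow, one_mul]
  rfl

theorem upsilonFun_add (f : R) (α : ℤ_[p]) (δ δ' : diffOp p R) :
    upsilonFun f α (δ + δ') = upsilonFun f α δ + upsilonFun f α δ' := by
  obtain ⟨e, h, h'⟩ := exists_common_level δ δ'
  rw [upsilonFun_eq f α δ h (α.appr_spec e), upsilonFun_eq f α δ' h' (α.appr_spec e),
    upsilonFun_eq f α (δ + δ') (add_mem h h') (α.appr_spec e)]
  exact conj_add f _ e h h'

/-- `Υ_α`, as a ring homomorphism from `D_R` to the additive endomorphisms of `R_f`. -/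
def upsilon (f : R) (α : ℤ_[p]) : diffOp p R →+* AddMonoid.End (Localization.Away f) where
  toFun := upsilonFun f α
  map_one' := by
    rw [upsilonFun_eq f α 1 (one_mem (diffOpLevel p R 0)) (α.appr_spec 0)]
    exact conj_one f _ 0
  map_mul' δ δ' := by
    obtain ⟨e, h, h'⟩ := exists_common_level δ δ'
    rw [upsilonFun_eq f α δ h (α.appr_spec e), upsilonFun_eq f α δ' h' (α.appr_spec e),
      upsilonFun_eq f α (δ * δ') (mul_mem h h') (α.appr_spec e)]
    exact conj_mul f _ e h h'
  map_zero' := by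
    have h := upsilonFun_add f α 0 0
    rw [add_zero] at h
    exact left_eq_add.mp h
  map_add' := upsilonFun_add f α

/-- The `D_R`-module `R_f f^α`: its underlying group is `R_f`, the element `g : R_f` standing
for `g f^α`, and `δ` acts by `δ • (g f^α) = Υ_α(δ)(g) f^α = f⁻ᵃ δ(fᵃ g) f^α`, where `a` is any
natural number with `a ≡ α` modulo `p ^ e` and `e` is any level of `δ`. -/
def TwistedLocalization (f : R) (_α : ℤ_[p]) : Type _ := Localization.Away f

instance (f : R) (α : ℤ_[p]) : AddCommGroup (TwistedLocalization f α) :=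
  inferInstanceAs (AddCommGroup (Localization.Away f))

instance (f : R) (α : ℤ_[p]) : Module (diffOp p R) (TwistedLocalization f α) :=
  Module.compHom (Localization.Away f) (upsilon f α)

theorem TwistedLocalization.smul_eq (f : R) (α : ℤ_[p]) (δ : diffOp p R) {e a : ℕ}
    (hδ : (δ : AddMonoid.End R) ∈ diffOpLevel p R e)
    (ha : α - a ∈ Ideal.span {(p : ℤ_[p]) ^ e}) (g : Localization.Away f) :
    δ • (show TwistedLocalization f α from g) =
      (IsLocalization.Away.invSelf f ^ a *
        locExtend (Submonoid.powers f) e δ hδ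
          (algebraMap R (Localization.Away f) f ^ a * g) : Localization.Away f) := by
  show upsilonFun f α δ g = _
  rw [upsilonFun_eq f α δ hδ ha, conj_apply]

end twisted

/-! ### Strongly `F`-regular rings, differential jumps, Bernstein-Sato roots, thresholds -/

/-- A domain `R` of characteristic `p` is strongly `F`-regular if for every nonzero `c : R` there
is some `e` such that the `R`-linear map `R → F^e_* R`, `1 ↦ F^e_* c`, splits. The left inverse is
a `p⁻ᵉ`-linear map `φ : R → R`. -/
def StronglyFRegular (p : ℕ) (R : Type*) [CommRing R] [IsDomain R] [CharP R p] : Prop :=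
  ∀ c : R, c ≠ 0 → ∃ (e : ℕ) (φ : R →+ R),
    (∀ r x : R, φ (r ^ p ^ e * x) = r * φ x) ∧ ∀ r : R, φ (r ^ p ^ e * c) = r

section jumps

variable (p : ℕ) {R : Type*} [CommRing R] (I : Ideal R)

/-- The `D_R^{(e)}`-submodule `D_R^{(e)} · I` of `R`. -/
def levelSpan (e : ℕ) (I : Ideal R) : Submodule (diffOpLevel p R e) R :=
  Submodule.span (diffOpLevel p R e) (I : Set R)

/-- The set of differential jumps of level `e` of the ideal `I`: the `n` such that the inclusion
`D_R^{(e)} · I ^ (n + 1) ⊆ D_R^{(e)} · I ^ n` is proper. -/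
def diffJumps (e : ℕ) : Set ℕ :=
  {n | levelSpan p e (I ^ (n + 1)) < levelSpan p e (I ^ n)}

/-- The `p`-adic integer `α` is a Bernstein-Sato root of `I`. -/
def IsBSRoot [Fact p.Prime] (α : ℤ_[p]) : Prop :=
  ∃ ν : ℕ → ℕ, (∀ e, ν e ∈ diffJumps p I e) ∧ Tendsto (fun e => (ν e : ℤ_[p])) atTop (𝓝 α)

/-- The real number `t` is a differential threshold of `I`. -/
def IsDiffThreshold (t : ℝ) : Prop :=
  0 ≤ t ∧ ∃ ν : ℕ → ℕ, (∀ e, ν e ∈ diffJumps p I e) ∧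
    Tendsto (fun e => (ν e : ℝ) / (p : ℝ) ^ e) atTop (𝓝 t)

/-- The ideal `I` is Bernstein-Sato admissible: `I` is generated by some `r` elements such that
the number of differential jumps of level `e` in `[0, r p ^ e)` is bounded uniformly in `e`. -/
def IsBSAdmissible : Prop :=
  ∃ (r : ℕ) (g : Fin r → R), Ideal.span (Set.range g) = I ∧
    ∃ C : ℕ, ∀ e : ℕ, (diffJumps p I e ∩ Set.Iio (r * p ^ e)).ncard ≤ C

end jumps

/-- A rational number in `ℤ_(p)`, that is, with denominator prime to `p`, viewed as a `p`-adic
integer. -/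
def ratToPadicInt (p : ℕ) [Fact p.Prime] (q : ℚ) (hq : ¬ p ∣ q.den) : ℤ_[p] :=
  ⟨(q : ℚ_[p]), Padic.norm_rat_le_one hq⟩

end BSRoot

end

/-! An integer `n` fails to be a jump of level `e` exactly when a level-`e` operator sends `f ^ (n +
1)` to `f ^ n`, so everything is about which powers of `f` reach which. Jumps of level `e` depend
only on `n` mod `p ^ e`, decrease with `e`, and, thanks to Frobenius splittings, are the floors `⌊j
/ p ^ d⌋` of jumps `j` of level `e + d`. Consequently `α` is a Bernstein–Sato root iff every natural
number congruent to `α` mod `p ^ e` is a jump of level `e` (`isBSRoot_iff`).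

Write `α = -u / (q - 1)` with `q = p ^ b`; the truncations of `α` are `N_k = u (1 + q + ⋯ + q ^ (k -
1))`, and `-α q ^ k = N_k - α` lies in `(N_k, N_k + 1]`. This ties roots to thresholds, the endpoint
`α = -1` needing strong `F`-regularity.

For a root, `f · f^α` does not generate `f^α`, so the module is not simple. Conversely, strong
`F`-regularity puts some `f ^ m f^α` in every nonzero submodule, so non-simplicity yields an integer
`m` for which every nonnegative `a + m` with `a ≡ α` mod `p ^ e` is a jump of level `e`. If `m ≠ 0`,
lifting many of the jumps `N_k + m` to one level gives distinct jumps below `q ^ K`, too many for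
admissibility (`eq_zero_of_forall_repdigit_add_mem`); hence `m = 0` and `α` is a root. -/

namespace BSRoot

/-! ### Differential jumps, Frobenius splittings and strong `F`-regularity -/

section reach

variable {p : ℕ} {R : Type*} [CommRing R]

theorem mulOp_mem_diffOpLevel (e : ℕ) (r : R) : mulOp r ∈ diffOpLevel p R e := by
  intro s x
  show r * (s ^ p ^ e * x) = s ^ p ^ e * (r * x)
  ring

variable (p) in
/-- Some differential operator of level `e` sends `f ^ m` to `f ^ n`. -/
def Reaches (f : R) (e n m : ℕ) : Prop :=
  ∃ δ ∈ diffOpLevel p R e, δ (f ^ m) = f ^ n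

theorem Reaches.trans {f : R} {e a b c : ℕ} (h : Reaches p f e a b) (h' : Reaches p f e b c) :
    Reaches p f e a c := by
  obtain ⟨δ, hδ, h⟩ := h
  obtain ⟨δ', hδ', h'⟩ := h'
  refine ⟨δ * δ', mul_mem hδ hδ', ?_⟩
  show δ (δ' (f ^ c)) = _
  rw [h', h]

theorem Reaches.of_le (f : R) (e : ℕ) {n m : ℕ} (h : m ≤ n) : Reaches p f e n m := by
  refine ⟨mulOp (f ^ (n - m)), mulOp_mem_diffOpLevel e _, ?_⟩
  show f ^ (n - m) * f ^ m = f ^ n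
  rw [← pow_add, Nat.sub_add_cancel h]

theorem Reaches.mono_level {f : R} {e e' n m : ℕ} (h : Reaches p f e n m) (he : e ≤ e') :
    Reaches p f e' n m := by
  obtain ⟨δ, hδ, h⟩ := h
  exact ⟨δ, diffOpLevel_mono p R he hδ, h⟩

theorem Reaches.add_right {f : R} {e n m : ℕ} (h : Reaches p f e n m) (k : ℕ) :
    Reaches p f e (n + p ^ e * k) (m + p ^ e * k) := by
  obtain ⟨δ, hδ, h⟩ := h
  refine ⟨δ, hδ, ?_⟩
  rw [add_comm m, add_comm n, pow_add, pow_add, ← h, mul_comm (p ^ e), pow_mul, hδ]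

theorem Reaches.of_add_right [IsDomain R] {f : R} (hf : f ≠ 0) {e n m k : ℕ}
    (h : Reaches p f e (n + p ^ e * k) (m + p ^ e * k)) : Reaches p f e n m := by
  obtain ⟨δ, hδ, h⟩ := h
  refine ⟨δ, hδ, ?_⟩
  rw [add_comm m, add_comm n, pow_add, pow_add, mul_comm (p ^ e), pow_mul, hδ] at h
  exact mul_left_cancel₀ (pow_ne_zero _ (pow_ne_zero _ hf)) h

theorem levelSpan_span_singleton_pow (f : R) (e n : ℕ) :
    levelSpan p e (Ideal.span {f} ^ n) = Submodule.span (diffOpLevel p R e) {f ^ n} := by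
  rw [levelSpan, Ideal.span_singleton_pow]
  apply le_antisymm
  · rw [Submodule.span_le]
    intro x hx
    obtain ⟨r, rfl⟩ := Ideal.mem_span_singleton'.mp hx
    exact Submodule.smul_mem _ (⟨mulOp r, mulOp_mem_diffOpLevel e r⟩ : diffOpLevel p R e)
      (Submodule.mem_span_singleton_self (f ^ n))
  · rw [Submodule.span_singleton_le_iff_mem]
    exact Submodule.subset_span (Ideal.mem_span_singleton_self _)

theorem pow_mem_levelSpan_iff {f : R} {e n m : ℕ} :
    f ^ n ∈ levelSpan p e (Ideal.span {f} ^ m) ↔ Reaches p f e n m := by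
  rw [levelSpan_span_singleton_pow, Submodule.mem_span_singleton]
  exact ⟨fun ⟨δ, h⟩ => ⟨δ.1, δ.2, h⟩, fun ⟨δ, hδ, h⟩ => ⟨⟨δ, hδ⟩, h⟩⟩

theorem notMem_diffJumps_iff {f : R} {e n : ℕ} :
    n ∉ diffJumps p (Ideal.span {f}) e ↔ Reaches p f e n (n + 1) := by
  have hle : levelSpan p e (Ideal.span {f} ^ (n + 1)) ≤ levelSpan p e (Ideal.span {f} ^ n) :=
    Submodule.span_mono (Ideal.pow_le_pow_right n.le_succ)
  rw [← pow_mem_levelSpan_iff, diffJumps, Set.mem_ofPred_eq, lt_iff_le_not_ge, not_and, not_not]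
  simp only [hle, true_imp_iff]
  rw [levelSpan_span_singleton_pow f e n, Submodule.span_singleton_le_iff_mem]

theorem reaches_iff_forall_notMem {f : R} {e n m : ℕ} :
    Reaches p f e n m ↔ ∀ j, n ≤ j → j < m → j ∉ diffJumps p (Ideal.span {f}) e := by
  simp only [notMem_diffJumps_iff]
  constructor
  · intro h j hn hm
    exact (Reaches.of_le f e hn).trans (h.trans (Reaches.of_le f e hm))
  · intro h
    rcases le_or_gt m n with hmn | hmn
    · exact Reaches.of_le f e hmn
    · induction m, hmn using Nat.le_induction with
      | base => exact h n le_rfl n.lt_succ_self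
      | succ m hm ih =>
        exact (ih fun j h1 h2 => h j h1 (h2.trans m.lt_succ_self)).trans
          (h m (by omega) m.lt_succ_self)

theorem diffJumps_antitone (f : R) : Antitone (diffJumps p (Ideal.span {f})) := by
  intro e e' he n hn
  by_contra h
  exact notMem_diffJumps_iff.mpr ((notMem_diffJumps_iff.mp h).mono_level he) hn

/-- Level-`e` operators commute with multiplication by the `p ^ e`-th power `f ^ (p ^ e * k)`, which
can be cancelled in a domain. -/
theorem add_mem_diffJumps_iff [IsDomain R] {f : R} (hf : f ≠ 0) {e n k : ℕ} :
    n + p ^ e * k ∈ diffJumps p (Ideal.span {f}) e ↔ n ∈ diffJumps p (Ideal.span {f}) e := by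
  rw [← not_iff_not, notMem_diffJumps_iff, notMem_diffJumps_iff, add_right_comm]
  exact ⟨fun h => h.of_add_right hf, fun h => h.add_right k⟩

theorem mem_diffJumps_congr [IsDomain R] {f : R} (hf : f ≠ 0) {e n n' : ℕ}
    (h : n ≡ n' [MOD p ^ e]) :
    n ∈ diffJumps p (Ideal.span {f}) e ↔ n' ∈ diffJumps p (Ideal.span {f}) e := by
  rw [← Nat.mod_add_div n (p ^ e), ← Nat.mod_add_div n' (p ^ e), add_mem_diffJumps_iff hf,
    add_mem_diffJumps_iff hf, show n % p ^ e = n' % p ^ e from h]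

/-- `φ` is a splitting of the `d`-th iterate of the Frobenius. -/
structure IsFrobeniusSplitting (p d : ℕ) (φ : R →+ R) : Prop where
  map_pow_mul : ∀ r x : R, φ (r ^ p ^ d * x) = r * φ x
  map_one : φ 1 = 1

theorem IsFrobeniusSplitting.map_pow {d : ℕ} {φ : R →+ R} (h : IsFrobeniusSplitting p d φ)
    (r : R) : φ (r ^ p ^ d) = r := by
  simpa [h.map_one] using h.map_pow_mul r 1

theorem IsFrobeniusSplitting.comp {e d : ℕ} {φ ψ : R →+ R}
    (hφ : IsFrobeniusSplitting p e φ) (hψ : IsFrobeniusSplitting p d ψ) :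
    IsFrobeniusSplitting p (e + d) (ψ.comp φ) where
  map_pow_mul r x := by
    show ψ (φ (r ^ p ^ (e + d) * x)) = r * ψ (φ x)
    rw [add_comm, pow_add, pow_mul, hφ.map_pow_mul, hψ.map_pow_mul]
  map_one := by
    show ψ (φ 1) = 1
    rw [hφ.map_one, hψ.map_one]

theorem diffJumps_eq_empty_of_isUnit {f : R} (hf : IsUnit f) (e : ℕ) :
    diffJumps p (Ideal.span {f}) e = ∅ := by
  refine Set.eq_empty_iff_forall_notMem.mpr fun n => notMem_diffJumps_iff.mpr ?_
  obtain ⟨u, rfl⟩ := hf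
  refine ⟨mulOp (↑u⁻¹ : R), mulOp_mem_diffOpLevel e _, ?_⟩
  show (↑u⁻¹ : R) * (u : R) ^ (n + 1) = u ^ n
  rw [pow_succ', ← mul_assoc, Units.inv_mul, one_mul]

/-- Since `f ≠ 0`, the number `r` of generators is positive, so the window `[0, r p ^ e)` contains
`[0, p ^ e)`. -/
theorem IsBSAdmissible.exists_ncard_le {f : R} (hf : f ≠ 0)
    (h : IsBSAdmissible p (Ideal.span {f})) :
    ∃ C : ℕ, ∀ e, (diffJumps p (Ideal.span {f}) e ∩ Set.Iio (p ^ e)).ncard ≤ C := by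
  obtain ⟨r, g, hg, C, hC⟩ := h
  refine ⟨C, fun e => le_trans (Set.ncard_le_ncard ?_ ?_) (hC e)⟩
  · have hr : r ≠ 0 := by
      rintro rfl
      rw [Set.range_eq_empty, Ideal.span_empty] at hg
      exact hf (Ideal.span_singleton_eq_bot.mp hg.symm)
    refine Set.inter_subset_inter_right _ (Set.Iio_subset_Iio ?_)
    exact Nat.le_mul_of_pos_left _ (Nat.pos_of_ne_zero hr)
  · exact (Set.finite_Iio _).inter_of_right _

variable [hp : Fact p.Prime] [CharP R p]

/-- With `F` the Frobenius, `δ ↦ φ ∘ δ ∘ F^d` lowers the level by `d` and `δ ↦ F^d ∘ δ ∘ φ` raises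
it by `d`. -/
theorem IsFrobeniusSplitting.reaches_iff {d : ℕ} {φ : R →+ R} (hφ : IsFrobeniusSplitting p d φ)
    {f : R} {e n m : ℕ} :
    Reaches p f (e + d) (n * p ^ d) (m * p ^ d) ↔ Reaches p f e n m := by
  constructor
  · rintro ⟨δ, hδ, h⟩
    refine ⟨φ.comp (δ.comp (iterateFrobenius R p d).toAddMonoidHom), fun r x => ?_, ?_⟩
    · show φ (δ ((r ^ p ^ e * x) ^ p ^ d)) = r ^ p ^ e * φ (δ (x ^ p ^ d))
      rw [mul_pow, ← pow_mul, ← pow_add, hδ, pow_add, pow_mul, hφ.map_pow_mul]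
    · show φ (δ ((f ^ m) ^ p ^ d)) = f ^ n
      rw [← pow_mul, h, pow_mul, hφ.map_pow]
  · rintro ⟨δ, hδ, h⟩
    refine ⟨(iterateFrobenius R p d).toAddMonoidHom.comp (AddMonoidHom.comp δ φ),
      fun r x => ?_, ?_⟩
    · show δ (φ (r ^ p ^ (e + d) * x)) ^ p ^ d = r ^ p ^ (e + d) * δ (φ x) ^ p ^ d
      rw [pow_add, pow_mul, hφ.map_pow_mul, hδ, mul_pow]
    · show δ (φ (f ^ (m * p ^ d))) ^ p ^ d = f ^ (n * p ^ d)
      rw [pow_mul, hφ.map_pow, h, pow_mul]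

/-- Going from `f ^ (k + 1)` to `f ^ k` at level `e` amounts to going from `f ^ ((k + 1) p ^ d)` to
`f ^ (k p ^ d)` at level `e + d`, that is, to having no jump of that level in between. -/
theorem IsFrobeniusSplitting.mem_diffJumps_iff {d : ℕ} {φ : R →+ R}
    (hφ : IsFrobeniusSplitting p d φ) {f : R} {e k : ℕ} :
    k ∈ diffJumps p (Ideal.span {f}) e ↔
      ∃ j ∈ diffJumps p (Ideal.span {f}) (e + d), j / p ^ d = k := by
  have hpos : 0 < p ^ d := pow_pos hp.out.pos d
  rw [← not_iff_not, notMem_diffJumps_iff, ← hφ.reaches_iff, reaches_iff_forall_notMem]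
  push Not
  refine forall_congr' fun j => ?_
  have : j / p ^ d = k ↔ k * p ^ d ≤ j ∧ j < (k + 1) * p ^ d := by
    rw [Nat.div_eq_iff hpos]
    have : 0 < p ^ d := hpos
    rw [add_mul]
    omega
  rw [Ne, this]
  tauto

theorem IsFrobeniusSplitting.of_le {e d : ℕ} (hd : d ≤ e) {φ : R →+ R}
    (hφ : IsFrobeniusSplitting p e φ) :
    IsFrobeniusSplitting p d (φ.comp (iterateFrobenius R p (e - d)).toAddMonoidHom) where
  map_pow_mul r x := by
    show φ ((r ^ p ^ d * x) ^ p ^ (e - d)) = r * φ (x ^ p ^ (e - d))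
    rw [mul_pow, ← pow_mul, ← pow_add, Nat.add_sub_cancel' hd, hφ.map_pow_mul]
  map_one := by
    show φ (1 ^ p ^ (e - d)) = 1
    rw [one_pow, hφ.map_one]

theorem IsFrobeniusSplitting.exists_of_pos {e : ℕ} (he : 0 < e) {φ : R →+ R}
    (hφ : IsFrobeniusSplitting p e φ) (d : ℕ) : ∃ ψ : R →+ R, IsFrobeniusSplitting p d ψ := by
  induction d with
  | zero => exact ⟨AddMonoidHom.id R, fun r x => by simp, rfl⟩
  | succ d ih =>
    obtain ⟨ψ, hψ⟩ := ih
    exact ⟨_, hψ.comp (hφ.of_le (d := 1) he)⟩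

variable [IsDomain R]

/-- The map `x ↦ φ (x c)` splits `F^e`. As `c` is not a unit, `e` is positive, so splittings of
every iterate follow by truncation and composition. -/
theorem StronglyFRegular.exists_isFrobeniusSplitting (hreg : StronglyFRegular p R) {c : R}
    (hc : c ≠ 0) (hu : ¬ IsUnit c) (d : ℕ) : ∃ ψ : R →+ R, IsFrobeniusSplitting p d ψ := by
  obtain ⟨e, φ, h1, h2⟩ := hreg c hc
  have he : 0 < e := by
    rcases Nat.eq_zero_or_pos e with rfl | he
    · refine absurd (IsUnit.of_mul_eq_one (φ 1) ?_) hu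
      have := h1 c 1
      rw [pow_zero, pow_one, mul_one] at this
      rw [← this]
      simpa using h2 1
    · exact he
  refine IsFrobeniusSplitting.exists_of_pos he (φ := φ.comp (AddMonoidHom.mulRight c)) ?_ d
  refine ⟨fun r x => ?_, ?_⟩
  · show φ (r ^ p ^ e * x * c) = r * φ (x * c)
    rw [mul_assoc, h1]
  · show φ (1 * c) = 1
    simpa using h2 1

/-- The operator is `F^e ∘ φ`, where `φ` is the splitting attached to `c`. -/
theorem StronglyFRegular.exists_map_eq_one (hreg : StronglyFRegular p R) {c : R}
    (hc : c ≠ 0) : ∃ e, ∃ δ ∈ diffOpLevel p R e, δ c = 1 := by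
  obtain ⟨e, φ, h1, h2⟩ := hreg c hc
  refine ⟨e, (iterateFrobenius R p e).toAddMonoidHom.comp φ, fun r x => ?_, ?_⟩
  · show φ (r ^ p ^ e * x) ^ p ^ e = r ^ p ^ e * φ x ^ p ^ e
    rw [h1, mul_pow]
  · show φ c ^ p ^ e = 1
    have := h2 1
    rw [one_pow, one_mul] at this
    rw [this, one_pow]

theorem StronglyFRegular.exists_notMem_diffJumps (hreg : StronglyFRegular p R) {f : R}
    (hf : f ≠ 0) (n : ℕ) : ∃ e, n ∉ diffJumps p (Ideal.span {f}) e := by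
  obtain ⟨e, δ, hδ, h⟩ := hreg.exists_map_eq_one (pow_ne_zero (n + 1) hf)
  refine ⟨e, notMem_diffJumps_iff.mpr ((Reaches.of_le f e n.zero_le).trans ⟨δ, hδ, ?_⟩)⟩
  rw [h, pow_zero]

theorem StronglyFRegular.mem_diffJumps_iff (hreg : StronglyFRegular p R) {f : R} (hf : f ≠ 0)
    {e k : ℕ} (d : ℕ) : k ∈ diffJumps p (Ideal.span {f}) e ↔
      ∃ j ∈ diffJumps p (Ideal.span {f}) (e + d), j / p ^ d = k := by
  by_cases hu : IsUnit f
  · simp [diffJumps_eq_empty_of_isUnit hu]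
  · obtain ⟨ψ, hψ⟩ := hreg.exists_isFrobeniusSplitting hf hu d
    exact hψ.mem_diffJumps_iff

end reach

/-! ### Bernstein–Sato roots through congruences -/

section padic

variable {p : ℕ} [hp : Fact p.Prime] {R : Type*} [CommRing R] [IsDomain R]

theorem modEq_of_sub_mem {α : ℤ_[p]} {e a b : ℕ} (ha : α - a ∈ Ideal.span {(p : ℤ_[p]) ^ e})
    (hb : α - b ∈ Ideal.span {(p : ℤ_[p]) ^ e}) : a ≡ b [MOD p ^ e] :=
  (appr_modEq α ha).symm.trans (appr_modEq α hb)

/-- In a convergent sequence, `ν_i ≡ α` mod `p ^ e` for large `i`, and `ν_i` is then also a jump of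
the smaller level `e`; jumps depend only on the residue. Conversely the truncations of `α` form a
sequence of jumps. -/
theorem isBSRoot_iff {f : R} (hf : f ≠ 0) {α : ℤ_[p]} :
    IsBSRoot p (Ideal.span {f}) α ↔ ∀ (e a : ℕ), α - a ∈ Ideal.span {(p : ℤ_[p]) ^ e} →
      a ∈ diffJumps p (Ideal.span {f}) e := by
  constructor
  · rintro ⟨ν, hν, hlim⟩ e a ha
    have hpos : (0 : ℝ) < (p : ℝ) ^ (-e : ℤ) := zpow_pos (by exact_mod_cast hp.out.pos) _
    obtain ⟨N, hN⟩ := Metric.tendsto_atTop.mp hlim _ hpos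
    have h1 := hN (max N e) (le_max_left _ _)
    rw [dist_comm, dist_eq_norm] at h1
    have h2 := (PadicInt.norm_le_pow_iff_mem_span_pow _ _).mp h1.le
    rw [← mem_diffJumps_congr hf (modEq_of_sub_mem h2 ha)]
    exact diffJumps_antitone f (le_max_right N e) (hν _)
  · intro h
    refine ⟨α.appr, fun e => h e _ (α.appr_spec e), ?_⟩
    rw [tendsto_iff_norm_sub_tendsto_zero]
    have hp1 : (1 : ℝ) < p := by exact_mod_cast hp.out.one_lt
    refine squeeze_zero (fun _ => norm_nonneg _) (fun e => ?_)
      (tendsto_pow_atTop_nhds_zero_of_lt_one (inv_nonneg.mpr (zero_le_one.trans hp1.le))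
        (inv_lt_one_of_one_lt₀ hp1))
    rw [norm_sub_rev]
    have := (PadicInt.norm_le_pow_iff_mem_span_pow _ _).mpr (α.appr_spec e)
    rwa [zpow_neg, zpow_natCast, ← inv_pow] at this

end padic

/-! ### Simplicity of `R_f f^α` in terms of jumps -/

section simple

variable {p : ℕ} [hp : Fact p.Prime] {R : Type*} [CommRing R]

/-- The image of `f` in `R_f`, as a unit. -/
noncomputable def awayUnit (f : R) : (Localization.Away f)ˣ where
  val := algebraMap R _ f
  inv := IsLocalization.Away.invSelf f
  val_inv := IsLocalization.Away.mul_invSelf f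
  inv_val := by rw [mul_comm]; exact IsLocalization.Away.mul_invSelf f

theorem val_awayUnit_pow (f : R) (n : ℕ) :
    ((awayUnit f ^ n : (Localization.Away f)ˣ) : Localization.Away f) =
      algebraMap R _ (f ^ n) := by
  rw [Units.val_pow_eq_pow_val, map_pow]
  rfl

theorem exists_eq_algebraMap_mul_awayUnit_zpow (f : R) (x : Localization.Away f) :
    ∃ (k : ℕ) (g : R), x = algebraMap R _ g * (awayUnit f ^ (-k : ℤ) : (Localization.Away f)ˣ) := by
  obtain ⟨k, g, hg⟩ := IsLocalization.Away.surj f x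
  refine ⟨k, g, ?_⟩
  rw [zpow_neg, zpow_natCast, Units.eq_mul_inv_iff_mul_eq, val_awayUnit_pow, map_pow, hg]

/-- An operator of level `e`, as an element of `D_R`. -/
def diffOp.ofLevel {e : ℕ} {δ : AddMonoid.End R} (hδ : δ ∈ diffOpLevel p R e) : diffOp p R :=
  ⟨δ, e, hδ⟩

namespace TwistedLocalization

/-- The element `g f^α` of `R_f f^α`, for `g` in `R_f`. -/
def mk (f : R) (α : ℤ_[p]) : Localization.Away f ≃+ TwistedLocalization f α :=
  AddEquiv.refl _

theorem smul_mk (f : R) (α : ℤ_[p]) {δ : AddMonoid.End R} {e a : ℕ}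
    (hδ : δ ∈ diffOpLevel p R e) (ha : α - a ∈ Ideal.span {(p : ℤ_[p]) ^ e})
    (g : Localization.Away f) :
    diffOp.ofLevel hδ • mk f α g = mk f α (IsLocalization.Away.invSelf f ^ a *
      locExtend (Submonoid.powers f) e δ hδ (algebraMap R (Localization.Away f) f ^ a * g)) :=
  smul_eq f α (diffOp.ofLevel hδ) hδ ha g

/-- The action on `g f^m f^α`, when `a ≡ α` modulo `p ^ e` and `n = a + m` is nonnegative. -/
theorem smul_mk_zpow_mul (f : R) (α : ℤ_[p]) {δ : AddMonoid.End R} {e a n : ℕ} {m : ℤ}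
    (hδ : δ ∈ diffOpLevel p R e) (ha : α - a ∈ Ideal.span {(p : ℤ_[p]) ^ e})
    (hn : (a : ℤ) + m = n) (g : R) :
    diffOp.ofLevel hδ •
      mk f α (((awayUnit f ^ m : (Localization.Away f)ˣ) : Localization.Away f) *
        algebraMap R _ g) =
      mk f α (((awayUnit f ^ (-a : ℤ) : (Localization.Away f)ˣ) : Localization.Away f) *
        algebraMap R _ (δ (f ^ n * g))) := by
  have h1 : algebraMap R (Localization.Away f) f ^ a *
      (((awayUnit f ^ m : (Localization.Away f)ˣ) : Localization.Away f) * algebraMap R _ g) =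
      algebraMap R _ (f ^ n * g) := by
    rw [map_mul, ← val_awayUnit_pow, ← zpow_natCast, ← hn, zpow_add, Units.val_mul, mul_assoc,
      zpow_natCast, val_awayUnit_pow, map_pow]
  have h2 : IsLocalization.Away.invSelf f ^ a =
      ((awayUnit f ^ (-a : ℤ) : (Localization.Away f)ˣ) : Localization.Away f) := by
    rw [zpow_neg, zpow_natCast, ← inv_pow, Units.val_pow_eq_pow_val]
    rfl
  rw [smul_mk f α hδ ha, h1, locExtend_algebraMap, h2]

theorem smul_mk_zpow (f : R) (α : ℤ_[p]) {δ : AddMonoid.End R} {e a n : ℕ} {m : ℤ}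
    (hδ : δ ∈ diffOpLevel p R e) (ha : α - a ∈ Ideal.span {(p : ℤ_[p]) ^ e})
    (hn : (a : ℤ) + m = n) :
    diffOp.ofLevel hδ • mk f α (awayUnit f ^ m : (Localization.Away f)ˣ) =
      mk f α (((awayUnit f ^ (-a : ℤ) : (Localization.Away f)ˣ) : Localization.Away f) *
        algebraMap R _ (δ (f ^ n))) := by
  have := smul_mk_zpow_mul f α hδ ha hn 1
  rwa [map_one, mul_one, mul_one] at this

theorem mulOp_smul_mk (f : R) (α : ℤ_[p]) (r : R) (x : Localization.Away f) :
    diffOp.ofLevel (p := p) (mulOp_mem_diffOpLevel 0 r) • mk f α x =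
      mk f α (algebraMap R _ r * x) := by
  have h := locExtend_unique (Submonoid.powers f) 0
    (locExtend_mem _ 0 _ (mulOp_mem_diffOpLevel (p := p) 0 r))
    (mulOp_mem_diffOpLevel 0 (algebraMap R (Localization (Submonoid.powers f)) r))
    (fun x => by
      rw [locExtend_algebraMap]
      exact map_mul (algebraMap R (Localization (Submonoid.powers f))) r x)
  rw [smul_mk f α (a := 0) (mulOp_mem_diffOpLevel 0 r) (by simp), pow_zero, pow_zero, one_mul,
    one_mul, h]
  rfl

end TwistedLocalization

open TwistedLocalization

variable [IsDomain R]

theorem algebraMap_away_injective {f : R} (hf : f ≠ 0) :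
    Function.Injective (algebraMap R (Localization.Away f)) :=
  IsLocalization.injective _ (powers_le_nonZeroDivisors_of_noZeroDivisors hf)

/-- An operator taking `f · f^α` to `f^α` would send `f ^ (a + 1)` to `f ^ a` for a truncation `a`
of `α`, which is a jump. -/
theorem not_isSimpleModule_of_isBSRoot {f : R} (hf : f ≠ 0) {α : ℤ_[p]}
    (h : IsBSRoot p (Ideal.span {f}) α) :
    ¬ IsSimpleModule (diffOp p R) (TwistedLocalization f α) := by
  intro hs
  have hinj := algebraMap_away_injective hf
  have : Nontrivial (Localization.Away f) := hinj.nontrivial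
  have hx : mk f α (awayUnit f ^ (1 : ℤ) : (Localization.Away f)ˣ) ≠ 0 := by
    rw [Ne, EmbeddingLike.map_eq_zero_iff]
    exact Units.ne_zero _
  obtain ⟨⟨δ, e, hδ⟩, hδx⟩ := IsSimpleModule.toSpanSingleton_surjective (diffOp p R) hx (mk f α 1)
  have ha := α.appr_spec e
  have h2 := (smul_mk_zpow f α hδ ha (n := α.appr e + 1) (by push_cast; rfl)).symm.trans hδx
  rw [EmbeddingLike.apply_eq_iff_eq, zpow_neg, Units.inv_mul_eq_iff_eq_mul, mul_one, zpow_natCast,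
    val_awayUnit_pow] at h2
  exact notMem_diffJumps_iff.mpr ⟨δ, hδ, hinj h2⟩ ((isBSRoot_iff hf).mp h e _ ha)

/-- After clearing denominators in a nonzero element, an operator sending its numerator `g` to `1`
is applied. -/
theorem exists_mk_zpow_mem [CharP R p] (hreg : StronglyFRegular p R) {f : R} (α : ℤ_[p])
    {W : Submodule (diffOp p R) (TwistedLocalization f α)} (hW : W ≠ ⊥) :
    ∃ m : ℤ, mk f α (awayUnit f ^ m : (Localization.Away f)ˣ) ∈ W := by
  obtain ⟨y, hxW, hy⟩ := W.ne_bot_iff.mp hW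
  obtain ⟨x, rfl⟩ := (mk f α).surjective y
  obtain ⟨k, g, rfl⟩ := exists_eq_algebraMap_mul_awayUnit_zpow f x
  have hg0 : g ≠ 0 := by
    rintro rfl
    rw [map_zero, zero_mul, map_zero] at hy
    exact hy rfl
  obtain ⟨e, δ, hδ, hδg⟩ := hreg.exists_map_eq_one hg0
  have hpe : 0 < p ^ e := pow_pos hp.out.pos e
  set a := α.appr e
  -- With this exponent `m`, `a + m = p ^ e * a`: the power of `f` seen by `δ` is a `p ^ e`-th
  -- power, so it passes through `δ` and only `δ g = 1` matters.
  refine ⟨(p : ℤ) ^ e * a - a, ?_⟩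
  have h1 := W.smul_mem (diffOp.ofLevel (mulOp_mem_diffOpLevel 0 (f ^ (k + (p ^ e - 1) * a)))) hxW
  have h2 : algebraMap R (Localization.Away f) (f ^ (k + (p ^ e - 1) * a)) *
      (algebraMap R _ g * (awayUnit f ^ (-k : ℤ) : (Localization.Away f)ˣ)) =
      ((awayUnit f ^ ((p : ℤ) ^ e * a - a) : (Localization.Away f)ˣ) : Localization.Away f) *
        algebraMap R _ g := by
    rw [← val_awayUnit_pow, mul_left_comm, ← Units.val_mul, mul_comm, ← zpow_natCast, ← zpow_add]
    congr 3
    push_cast [Nat.cast_sub hpe]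
    ring
  rw [mulOp_smul_mk, h2] at h1
  have h3 := W.smul_mem (diffOp.ofLevel hδ) h1
  rw [smul_mk_zpow_mul f α hδ (α.appr_spec e) (n := p ^ e * a) (by push_cast; ring) g,
    mul_comm (p ^ e), pow_mul, hδ, hδg, mul_one, ← pow_mul, ← val_awayUnit_pow, ← zpow_natCast,
    ← Units.val_mul, ← zpow_add] at h3
  convert h3 using 5
  push_cast
  ring

/-- If every `m` had a non-jump `a + m`, one could descend from `f ^ (m + 1) f^α` to `f ^ m f^α`
inside any submodule. A nonzero submodule would then contain arbitrarily negative powers of `f`,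
hence be everything. -/
theorem exists_forall_mem_diffJumps_of_not_isSimpleModule [CharP R p]
    (hreg : StronglyFRegular p R) {f : R} (hf : f ≠ 0) {α : ℤ_[p]}
    (h : ¬ IsSimpleModule (diffOp p R) (TwistedLocalization f α)) :
    ∃ m : ℤ, ∀ e a n : ℕ, α - a ∈ Ideal.span {(p : ℤ_[p]) ^ e} → (a : ℤ) + m = n →
      n ∈ diffJumps p (Ideal.span {f}) e := by
  by_contra! hcon
  apply h
  have : Nontrivial (Localization.Away f) := (algebraMap_away_injective hf).nontrivial
  have : Nontrivial (TwistedLocalization f α) := (mk f α).injective.nontrivial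
  rw [isSimpleModule_iff]
  refine ⟨fun W => or_iff_not_imp_left.mpr fun hW => ?_⟩
  obtain ⟨m₀, hm₀⟩ := exists_mk_zpow_mem hreg α hW
  have step : ∀ m : ℤ, mk f α (awayUnit f ^ (m + 1) : (Localization.Away f)ˣ) ∈ W →
      mk f α (awayUnit f ^ m : (Localization.Away f)ˣ) ∈ W := by
    intro m hm
    obtain ⟨e, a, n, ha, hn, hj⟩ := hcon m
    obtain ⟨δ, hδ, hδf⟩ := notMem_diffJumps_iff.mp hj
    have h1 := W.smul_mem (diffOp.ofLevel hδ) hm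
    rw [smul_mk_zpow f α hδ ha (n := n + 1) (by push_cast; linarith), hδf, ← val_awayUnit_pow,
      ← Units.val_mul, ← zpow_natCast, ← zpow_add, ← hn, neg_add_cancel_left] at h1
    exact h1
  have all : ∀ k : ℕ, mk f α (awayUnit f ^ (m₀ - k) : (Localization.Away f)ˣ) ∈ W := by
    intro k
    induction k with
    | zero => simpa using hm₀
    | succ k ih =>
      refine step _ ?_
      rwa [Nat.cast_succ, ← sub_sub, sub_add_cancel]
  rw [Submodule.eq_top_iff']
  intro y
  obtain ⟨x, rfl⟩ := (mk f α).surjective y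
  obtain ⟨k, g, rfl⟩ := exists_eq_algebraMap_mul_awayUnit_zpow f x
  -- The extra factor is `f` to the negative part of `m₀`; it makes the total exponent `-k` whatever
  -- the sign of `m₀`.
  have h1 := W.smul_mem
    (diffOp.ofLevel (mulOp_mem_diffOpLevel 0 (g * f ^ (m₀.toNat - m₀).toNat))) (all (k + m₀.toNat))
  rw [mulOp_smul_mk, map_mul (algebraMap R _), mul_assoc, ← val_awayUnit_pow, ← Units.val_mul, ← zpow_natCast,
    ← zpow_add] at h1
  convert h1 using 5
  have := Int.self_le_toNat m₀
  push_cast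
  omega

end simple

/-! ### Periodic expansions and the counting argument -/

section periodic

open Finset in
/-- The natural number with `k` digits, all of them equal to `u`, in base `q`. -/
def repdigit (u q k : ℕ) : ℕ := u * ∑ i ∈ range k, q ^ i

theorem repdigit_mul_sub_one {A : Type*} [CommRing A] (u q k : ℕ) :
    (repdigit u q k : A) * (q - 1) = u * ((q : A) ^ k - 1) := by
  rw [repdigit]
  push_cast
  rw [mul_assoc, geom_sum_mul]

theorem repdigit_add (u q d k : ℕ) :
    repdigit u q (d + k) = q ^ d * repdigit u q k + repdigit u q d := by
  simp only [repdigit, Finset.sum_range_add, pow_add, ← Finset.mul_sum]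
  ring

theorem le_repdigit {u q : ℕ} (hu : 0 < u) (hq : 0 < q) (k : ℕ) : k ≤ repdigit u q k := by
  refine le_trans ?_ (Nat.le_mul_of_pos_left _ hu)
  calc k = ∑ i ∈ Finset.range k, 1 := by simp
    _ ≤ _ := Finset.sum_le_sum fun i _ => Nat.one_le_pow _ _ hq

theorem repdigit_sub_one_add_one {q : ℕ} (hq : 0 < q) (k : ℕ) : repdigit (q - 1) q k + 1 = q ^ k := by
  induction k with
  | zero => simp [repdigit]
  | succ k ih =>
    have h1 : repdigit (q - 1) q 1 + 1 = q := by
      simp only [repdigit, Finset.range_one, Finset.sum_singleton, pow_zero, mul_one]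
      omega
    rw [repdigit_add, add_assoc, ih, ← Nat.mul_succ, Nat.succ_eq_add_one, h1, pow_succ]

/-- The defect from `q ^ k - 1`, the repdigit of `q - 1`, is the repdigit of the positive digit `q -
1 - u`, which is at least `k`. -/
theorem repdigit_add_lt_pow {u q : ℕ} (h : u + 1 < q) (k : ℕ) :
    repdigit u q k + k < q ^ k := by
  have hq : 0 < q := by omega
  have h1 : repdigit (q - 1) q k = repdigit u q k + repdigit (q - 1 - u) q k := by
    rw [repdigit, repdigit, repdigit, ← add_mul]
    congr 1
    omega
  have h2 := repdigit_sub_one_add_one hq k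
  have h3 := le_repdigit (u := q - 1 - u) (by omega) hq k
  omega

/-- If sets `J k` with a bounded number of elements below `q ^ k` are such that elements of `J k`
extend to elements of `J (k + d)` with the same leading digits in base `q`, then `J k` cannot
always contain the translate of a repdigit by a nonzero integer `m`. -/
theorem eq_zero_of_forall_repdigit_add_mem {J : ℕ → Set ℕ} {u q C : ℕ} {m : ℤ} (hu : 0 < u)
    (hq : 0 < q) (hext : ∀ k d x, x ∈ J k → ∃ y ∈ J (k + d), y / q ^ d = x)
    (hC : ∀ k, (J k ∩ Set.Iio (q ^ k)).ncard ≤ C)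
    (hJ : ∀ k n : ℕ, (repdigit u q k : ℤ) + m = n → n ∈ J k)
    (hlt : ∀ k : ℕ, m.natAbs ≤ k → (repdigit u q k : ℤ) + m < (q : ℤ) ^ k) : m = 0 := by
  by_contra hm
  have hm' : 0 < m.natAbs := Int.natAbs_pos.mpr hm
  -- Multiples of `|m|` make each length, and each difference of two lengths, at least `|m|`; so the
  -- translates by `m` are nonnegative.
  set k : ℕ → ℕ := fun i => m.natAbs * (i + 1) with hk
  have hkm : ∀ i, m.natAbs ≤ k i := fun i => Nat.le_mul_of_pos_right _ i.succ_pos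
  have hn : ∀ i, ∃ n : ℕ, (repdigit u q (k i) : ℤ) + m = n := fun i => by
    refine Int.eq_ofNat_of_zero_le ?_
    have h1 := le_repdigit hu hq (k i)
    have h2 := hkm i
    omega
  choose n hn using hn
  -- All `C + 1` jumps are lifted to the common level `k C`, keeping their leading digits.
  have hx : ∀ i : Fin (C + 1), ∃ x ∈ J (k C), x / q ^ (k C - k i) = n i := fun i => by
    have h1 : k i ≤ k C := Nat.mul_le_mul_left _ (by omega)
    have := hext (k i) (k C - k i) (n i) (hJ _ _ (hn i))
    rwa [Nat.add_sub_cancel' h1] at this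
  choose x hxJ hxn using hx
  have hne : ∀ i j : Fin (C + 1), i < j → x i ≠ x j := by
    intro i j hij heq
    obtain ⟨c, hc⟩ := Nat.exists_eq_add_of_lt (Fin.lt_def.mp hij)
    have hkd : k j = m.natAbs * (c + 1) + k i := by
      simp only [hk, hc]
      ring
    have hKj : k j ≤ k C := Nat.mul_le_mul_left _ (by omega)
    have h1 := hxn i
    have h2 : k C - k i = (k C - k j) + m.natAbs * (c + 1) := by omega
    -- Equal lifts force `⌊n j / q ^ d⌋ = n i`. Since `n j = q ^ d * (n i - m) + N_d + m`, this says
    -- `q ^ d * m ≤ N_d + m < q ^ d * (m + 1)`, whereas `0 ≤ N_d + m < q ^ d`; hence `m = 0`.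
    rw [h2, pow_add, ← Nat.div_div_eq_div_mul, heq, hxn j] at h1
    have hni := hn i
    have hnj := hn j
    set d := m.natAbs * (c + 1)
    have hdm : m.natAbs ≤ d := Nat.le_mul_of_pos_right _ c.succ_pos
    have hlt := hlt d hdm
    have hle := le_repdigit hu hq d
    rw [hkd, repdigit_add] at hnj
    have hqd : 0 < q ^ d := pow_pos hq d
    obtain ⟨h3, h4⟩ := (Nat.div_eq_iff hqd).mp h1
    have h5 : n j < n i * q ^ d + q ^ d := by omega
    zify at h3 h5 hqd
    push_cast at hnj
    rw [← hnj, ← hni] at h3 h5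
    rcases lt_or_gt_of_ne hm with hneg | hpos
    · have : 0 ≤ (repdigit u q d : ℤ) + m := by omega
      nlinarith
    · nlinarith
  have hinj : Function.Injective x := fun i j h => by
    by_contra hij
    rcases lt_or_gt_of_ne hij with h' | h'
    · exact hne i j h' h
    · exact hne j i h' h.symm
  have hsub : Set.range x ⊆ J (k C) ∩ Set.Iio (q ^ k C) := by
    rintro _ ⟨i, rfl⟩
    refine ⟨hxJ i, ?_⟩
    have h1 := hlt (k i) (hkm i)
    rw [hn i] at h1
    have h2 : n i < q ^ k i := by exact_mod_cast h1
    rw [← hxn i, Nat.div_lt_iff_lt_mul (pow_pos hq _), ← pow_add] at h2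
    rwa [Nat.add_sub_cancel' (Nat.mul_le_mul_left _ (by omega))] at h2
  have h1 := Set.ncard_le_ncard hsub ((Set.finite_Iio _).inter_of_right _)
  rw [← Set.image_univ, Set.ncard_image_of_injective _ hinj, Set.ncard_univ, Nat.card_fin] at h1
  have := hC (k C)
  omega

/-- By Euler's theorem the denominator of `α` divides `p ^ b - 1` for `b` its totient. -/
theorem exists_mul_pow_sub_one_eq_neg {p : ℕ} (hp : p.Prime) {α : ℚ} (hα : ¬ p ∣ α.den)
    (hα₁ : -1 ≤ α) (hα₀ : α < 0) :
    ∃ b u : ℕ, 0 < b ∧ 0 < u ∧ u + 1 ≤ p ^ b ∧ α * ((p : ℚ) ^ b - 1) = -u := by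
  have hb : 0 < α.den.totient := Nat.totient_pos.mpr α.den_pos
  have h1 : 1 < p ^ α.den.totient := Nat.one_lt_pow hb.ne' hp.one_lt
  have hmod := Nat.ModEq.pow_totient ((Nat.Prime.coprime_iff_not_dvd hp).mpr hα)
  obtain ⟨c, hc⟩ := (Nat.modEq_iff_dvd' h1.le).mp hmod.symm
  have hc' : (p : ℚ) ^ α.den.totient - 1 = α.den * c := by
    rw [← Nat.cast_mul, ← hc, Nat.cast_sub h1.le]
    push_cast
    rfl
  have hz : α * ((p : ℚ) ^ α.den.totient - 1) = ((α.num * c : ℤ) : ℚ) := by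
    rw [hc', ← mul_assoc, Rat.mul_den_eq_num]
    push_cast
    rfl
  have hpos : 0 < (p : ℚ) ^ α.den.totient - 1 := by
    rw [sub_pos]
    exact_mod_cast h1
  have hneg : α.num * c < 0 := by
    have : ((α.num * c : ℤ) : ℚ) < 0 := hz ▸ mul_neg_of_neg_of_pos hα₀ hpos
    exact_mod_cast this
  have hu : (((α.num * c).natAbs : ℕ) : ℚ) = -((α.num * c : ℤ) : ℚ) := by
    rw [← Int.cast_natCast, Int.ofNat_natAbs_of_nonpos hneg.le, Int.cast_neg]
  refine ⟨α.den.totient, (α.num * c).natAbs, hb, Int.natAbs_pos.mpr hneg.ne, ?_, ?_⟩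
  · have : (((α.num * c).natAbs + 1 : ℕ) : ℚ) ≤ ((p ^ α.den.totient : ℕ) : ℚ) := by
      push_cast [hu, ← hz]
      nlinarith
    exact_mod_cast this
  · rw [hz, hu, neg_neg]

/-- With `q = p ^ b`, multiplying the difference by `q - 1`, which is prime to `p`, gives `-u - u (q
^ k - 1) = -u q ^ k`. -/
theorem ratToPadicInt_sub_repdigit_mem {p : ℕ} [hp : Fact p.Prime] {α : ℚ} (hα : ¬ p ∣ α.den)
    {b u : ℕ} (h : α * ((p : ℚ) ^ b - 1) = -u) (k : ℕ) :
    ratToPadicInt p α hα - (repdigit u (p ^ b) k : ℕ) ∈ Ideal.span {(p : ℤ_[p]) ^ (b * k)} := by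
  rw [Ideal.mem_span_singleton]
  have h1 : ratToPadicInt p α hα * ((p : ℤ_[p]) ^ b - 1) = -u := by
    apply Subtype.ext
    have : ((α * ((p : ℚ) ^ b - 1) : ℚ) : ℚ_[p]) = ((-u : ℚ) : ℚ_[p]) := by rw [h]
    push_cast at this ⊢
    exact this
  have h2 := repdigit_mul_sub_one (A := ℤ_[p]) u (p ^ b) k
  have hcop : IsCoprime ((p : ℤ_[p]) ^ (b * k)) ((p : ℤ_[p]) ^ b - 1) := by
    rw [pow_mul]
    exact IsCoprime.pow_left ⟨1, -1, by ring⟩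
  refine hcop.dvd_of_dvd_mul_right ⟨-u, ?_⟩
  push_cast at h2
  rw [sub_mul, h1, h2, pow_mul]
  ring

end periodic

/-! ### Roots, thresholds and non-simplicity -/

section thresholds

variable {p : ℕ} [hp : Fact p.Prime] {R : Type*} [CommRing R] [IsDomain R] {f : R} {α : ℚ}

theorem isBSRoot_of_forall_repdigit_mem {b u : ℕ} (hf : f ≠ 0) (hα : ¬ p ∣ α.den)
    (hb : 0 < b) (h : α * ((p : ℚ) ^ b - 1) = -u) {k₀ : ℕ}
    (hmem : ∀ k, k₀ ≤ k → repdigit u (p ^ b) k ∈ diffJumps p (Ideal.span {f}) (b * k)) :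
    IsBSRoot p (Ideal.span {f}) (ratToPadicInt p α hα) := by
  rw [isBSRoot_iff hf]
  intro e a ha
  have hle : e ≤ b * max k₀ e := (le_max_right _ _).trans (Nat.le_mul_of_pos_left _ hb)
  have h1 := ratToPadicInt_sub_repdigit_mem hα h (max k₀ e)
  have h2 := Ideal.span_singleton_le_span_singleton.mpr (pow_dvd_pow (p : ℤ_[p]) hle) h1
  rw [← mem_diffJumps_congr hf (modEq_of_sub_mem h2 ha)]
  exact diffJumps_antitone f hle (hmem _ (le_max_left _ _))

variable [CharP R p]

/-- A jump of high level `e + d` close to the threshold lies between `a p ^ d` and `c p ^ d`; its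
quotient by `p ^ d` is a jump of level `e`. -/
theorem IsDiffThreshold.exists_mem_diffJumps (hreg : StronglyFRegular p R) (hf : f ≠ 0)
    {t : ℝ} (h : IsDiffThreshold p (Ideal.span {f}) t) {e a c : ℕ} (ha : a < t * (p : ℝ) ^ e)
    (hc : t * (p : ℝ) ^ e < c) : ∃ y ∈ diffJumps p (Ideal.span {f}) e, a ≤ y ∧ y < c := by
  obtain ⟨-, ν, hν, hlim⟩ := h
  have hpos : ∀ k, (0 : ℝ) < (p : ℝ) ^ k := fun k => pow_pos (by exact_mod_cast hp.out.pos) k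
  have hev := hlim.eventually (Ioo_mem_nhds ((div_lt_iff₀ (hpos e)).mpr ha)
    ((lt_div_iff₀ (hpos e)).mpr hc))
  obtain ⟨e', ⟨h1, h2⟩, he⟩ := (hev.and (eventually_ge_atTop e)).exists
  obtain ⟨d, rfl⟩ := Nat.exists_eq_add_of_le he
  rw [div_lt_div_iff₀ (hpos _) (hpos _), pow_add] at h1 h2
  have h1 : (a : ℝ) * (p : ℝ) ^ d < ν (e + d) :=
    lt_of_mul_lt_mul_right (by linarith) (hpos e).le
  have h2 : (ν (e + d) : ℝ) < (c : ℝ) * (p : ℝ) ^ d :=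
    lt_of_mul_lt_mul_right (by linarith) (hpos e).le
  have h1 : a * p ^ d < ν (e + d) := by exact_mod_cast h1
  have h2 : ν (e + d) < c * p ^ d := by exact_mod_cast h2
  have hd : 0 < p ^ d := pow_pos hp.out.pos d
  exact ⟨ν (e + d) / p ^ d, (hreg.mem_diffJumps_iff hf d).mpr ⟨_, hν _, rfl⟩,
    (Nat.le_div_iff_mul_le hd).mpr h1.le, (Nat.div_lt_iff_lt_mul hd).mpr h2⟩

theorem IsDiffThreshold.isBSRoot (hreg : StronglyFRegular p R) (hf : f ≠ 0) (hα : ¬ p ∣ α.den)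
    (hα₁ : -1 ≤ α) (hα₀ : α < 0) (ht : IsDiffThreshold p (Ideal.span {f}) (-(α : ℝ))) :
    IsBSRoot p (Ideal.span {f}) (ratToPadicInt p α hα) := by
  obtain ⟨b, u, hb, hu, hup, h⟩ := exists_mul_pow_sub_one_eq_neg hp.out hα hα₁ hα₀
  obtain ⟨e₀, he₀⟩ := hreg.exists_notMem_diffJumps hf 0
  refine isBSRoot_of_forall_repdigit_mem hf hα hb h (k₀ := e₀) fun k hk => ?_
  have hq : (1 : ℝ) < (p : ℝ) ^ b := one_lt_pow₀ (by exact_mod_cast hp.out.one_lt) hb.ne'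
  have hR : (α : ℝ) * ((p : ℝ) ^ b - 1) = -u := by exact_mod_cast h
  have hN : (repdigit u (p ^ b) k : ℝ) = -(α : ℝ) * (p : ℝ) ^ (b * k) + α := by
    have h1 := repdigit_mul_sub_one (A := ℝ) u (p ^ b) k
    push_cast at h1
    have h2 : (u : ℝ) = -α * ((p : ℝ) ^ b - 1) := by linarith
    rw [h2, ← pow_mul] at h1
    apply mul_right_cancel₀ (sub_pos.mpr hq).ne'
    rw [h1]
    ring
  have hα₀' : (α : ℝ) < 0 := by exact_mod_cast hα₀
  have hα₁' : (-1 : ℝ) ≤ α := by exact_mod_cast hα₁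
  rcases hα₁'.lt_or_eq with hlt | heq
  · obtain ⟨y, hy, h1, h2⟩ := ht.exists_mem_diffJumps hreg hf (e := b * k)
      (a := repdigit u (p ^ b) k) (c := repdigit u (p ^ b) k + 1) (by linarith)
      (by push_cast; linarith)
    obtain rfl : y = repdigit u (p ^ b) k := by omega
    exact hy
  -- For `α = -1` the number `-α q ^ k` is the integer `N_k + 1`, so the window must hold two
  -- candidates. The unwanted one is `q ^ k ≡ 0`, and `0` is not a jump of level at least `e₀`.
  · obtain ⟨y, hy, h1, h2⟩ := ht.exists_mem_diffJumps hreg hf (e := b * k)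
      (a := repdigit u (p ^ b) k) (c := repdigit u (p ^ b) k + 2) (by linarith)
      (by push_cast; linarith)
    rcases (show y = repdigit u (p ^ b) k ∨ y = repdigit u (p ^ b) k + 1 by omega) with rfl | rfl
    · exact hy
    · have h3 : repdigit u (p ^ b) k + 1 = 0 + p ^ (b * k) * 1 := by
        have : ((repdigit u (p ^ b) k + 1 : ℕ) : ℝ) = ((0 + p ^ (b * k) * 1 : ℕ) : ℝ) := by
          push_cast
          rw [hN, ← heq]
          ring
        exact_mod_cast this
      rw [h3, add_mem_diffJumps_iff hf] at hy
      exact absurd (diffJumps_antitone f (hk.trans (Nat.le_mul_of_pos_left k hb)) hy) he₀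

theorem IsBSRoot.isDiffThreshold (hreg : StronglyFRegular p R) (hf : f ≠ 0) (hα : ¬ p ∣ α.den)
    (hα₁ : -1 ≤ α) (hα₀ : α < 0) (hr : IsBSRoot p (Ideal.span {f}) (ratToPadicInt p α hα)) :
    IsDiffThreshold p (Ideal.span {f}) (-(α : ℝ)) := by
  obtain ⟨b, u, hb, hu, hup, h⟩ := exists_mul_pow_sub_one_eq_neg hp.out hα hα₁ hα₀
  have hα₀' : (α : ℝ) < 0 := by exact_mod_cast hα₀
  have hα₁' : (-1 : ℝ) ≤ α := by exact_mod_cast hα₁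
  have hp1 : (1 : ℝ) < p := by exact_mod_cast hp.out.one_lt
  have hq : (1 : ℝ) < (p : ℝ) ^ b := one_lt_pow₀ hp1 hb.ne'
  have hle : ∀ e, e + (b * e - e) = b * e := fun e =>
    Nat.add_sub_cancel' (Nat.le_mul_of_pos_left e hb)
  -- The jump `N_e` has level `b * e`; dropping its last `b * e - e` base-`p` digits gives one of
  -- level `e`.
  refine ⟨by linarith, fun e => repdigit u (p ^ b) e / p ^ (b * e - e), fun e => ?_, ?_⟩
  · refine (hreg.mem_diffJumps_iff hf (b * e - e)).mpr ⟨_, ?_, rfl⟩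
    rw [hle]
    exact (isBSRoot_iff hf).mp hr _ _ (ratToPadicInt_sub_repdigit_mem hα h e)
  -- The `2` is one unit lost to the floor and one to `α / p ^ (b * e - e) ≥ -1`.
  have hbound : ∀ e, -(α : ℝ) - 2 * (p : ℝ)⁻¹ ^ e ≤
      (repdigit u (p ^ b) e / p ^ (b * e - e) : ℕ) / (p : ℝ) ^ e ∧
      (repdigit u (p ^ b) e / p ^ (b * e - e) : ℕ) / (p : ℝ) ^ e ≤ -(α : ℝ) := by
    intro e
    have hR : (α : ℝ) * ((p : ℝ) ^ b - 1) = -u := by exact_mod_cast h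
    have hN : (repdigit u (p ^ b) e : ℝ) =
        -(α : ℝ) * ((p : ℝ) ^ e * (p : ℝ) ^ (b * e - e)) + α := by
      have h1 := repdigit_mul_sub_one (A := ℝ) u (p ^ b) e
      push_cast at h1
      have h2 : (u : ℝ) = -α * ((p : ℝ) ^ b - 1) := by linarith
      rw [h2, ← pow_mul] at h1
      apply mul_right_cancel₀ (sub_pos.mpr hq).ne'
      rw [h1, ← pow_add, hle]
      ring
    have hQ : 0 < p ^ (b * e - e) := pow_pos hp.out.pos _
    have h1 := Nat.div_mul_le_self (repdigit u (p ^ b) e) (p ^ (b * e - e))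
    have h2 := Nat.lt_mul_of_div_lt (Nat.lt_succ_self (repdigit u (p ^ b) e / p ^ (b * e - e))) hQ
    generalize repdigit u (p ^ b) e / p ^ (b * e - e) = y at h1 h2 ⊢
    have h1 : (y : ℝ) * (p : ℝ) ^ (b * e - e) ≤ repdigit u (p ^ b) e := by exact_mod_cast h1
    have h2 : (repdigit u (p ^ b) e : ℝ) < ((y : ℝ) + 1) * (p : ℝ) ^ (b * e - e) := by
      exact_mod_cast h2
    have hQ : (1 : ℝ) ≤ (p : ℝ) ^ (b * e - e) := one_le_pow₀ hp1.le
    have hP : (0 : ℝ) < (p : ℝ) ^ e := pow_pos (by linarith) e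
    rw [hN] at h1 h2
    generalize (p : ℝ) ^ (b * e - e) = Q at *
    have h3 : (y : ℝ) ≤ -α * (p : ℝ) ^ e := by
      refine le_of_mul_le_mul_right ?_ (zero_lt_one.trans_le hQ)
      linarith
    have h4 : -α * (p : ℝ) ^ e - 2 ≤ y := by
      refine le_of_mul_le_mul_right ?_ (zero_lt_one.trans_le hQ)
      linarith
    refine ⟨?_, (div_le_iff₀ hP).mpr h3⟩
    rw [le_div_iff₀ hP, sub_mul, mul_assoc, ← mul_pow, inv_mul_cancel₀ (by linarith), one_pow]
    linarith
  have h0 : Tendsto (fun e => -(α : ℝ) - 2 * (p : ℝ)⁻¹ ^ e) atTop (𝓝 (-(α : ℝ))) := by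
    have := (tendsto_pow_atTop_nhds_zero_of_lt_one (r := (p : ℝ)⁻¹) (by positivity)
      (inv_lt_one_of_one_lt₀ hp1)).const_mul 2
    simpa using tendsto_const_nhds (x := -(α : ℝ)) |>.sub this
  exact tendsto_of_tendsto_of_tendsto_of_le_of_le h0 tendsto_const_nhds
    (fun e => (hbound e).1) (fun e => (hbound e).2)

/-- The shift `m` given by non-simplicity is killed by the counting argument, except for `α = -1`
and `m > 0`, where the translates exceed the window. -/
theorem isBSRoot_of_not_isSimpleModule (hreg : StronglyFRegular p R) (hf : f ≠ 0)
    (hadm : IsBSAdmissible p (Ideal.span {f})) (hα : ¬ p ∣ α.den) (hα₁ : -1 ≤ α) (hα₀ : α < 0)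
    (hs : ¬ IsSimpleModule (diffOp p R) (TwistedLocalization f (ratToPadicInt p α hα))) :
    IsBSRoot p (Ideal.span {f}) (ratToPadicInt p α hα) := by
  obtain ⟨m, hm⟩ := exists_forall_mem_diffJumps_of_not_isSimpleModule hreg hf hs
  suffices m = 0 by
    subst this
    rw [isBSRoot_iff hf]
    exact fun e a ha => hm e a a ha (add_zero _)
  obtain ⟨b, u, hb, hu, hup, h⟩ := exists_mul_pow_sub_one_eq_neg hp.out hα hα₁ hα₀
  obtain ⟨C, hC⟩ := hadm.exists_ncard_le hf
  have hmem : ∀ k n : ℕ, (repdigit u (p ^ b) k : ℤ) + m = n →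
      n ∈ diffJumps p (Ideal.span {f}) (b * k) := fun k n hn =>
    hm _ _ _ (ratToPadicInt_sub_repdigit_mem hα h k) hn
  have hq : 0 < p ^ b := pow_pos hp.out.pos b
  have main : (∀ k : ℕ, m.natAbs ≤ k → (repdigit u (p ^ b) k : ℤ) + m < ((p ^ b : ℕ) : ℤ) ^ k) →
      m = 0 := by
    refine eq_zero_of_forall_repdigit_add_mem (J := fun k => diffJumps p (Ideal.span {f}) (b * k))
      hu hq (fun k d x hx => ?_) (fun k => by rw [← pow_mul]; exact hC _) hmem
    rw [mul_add, ← pow_mul]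
    exact (hreg.mem_diffJumps_iff hf _).mp hx
  rcases hup.lt_or_eq with hlt | heq
  · refine main fun k hk => ?_
    have := repdigit_add_lt_pow hlt k
    zify at this hk
    have := Int.le_natAbs (a := m)
    push_cast at *
    omega
  · obtain rfl : u = p ^ b - 1 := by omega
    rcases le_or_gt m 0 with hm0 | hm0
    · refine main fun k _ => ?_
      have := repdigit_sub_one_add_one hq k
      zify at this
      push_cast at *
      omega
    -- Here `N_e + m = q ^ e + (m - 1)`, so periodicity would make `m - 1` a jump of every level,
    -- against strong `F`-regularity.
    · exfalso
      obtain ⟨n, rfl⟩ := Int.eq_succ_of_zero_lt hm0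
      obtain ⟨e, he⟩ := hreg.exists_notMem_diffJumps hf n
      have h1 := hmem e (n + p ^ (b * e) * 1) (by
        rw [pow_mul, ← repdigit_sub_one_add_one hq e]
        push_cast
        ring)
      rw [add_mem_diffJumps_iff hf] at h1
      exact he (diffJumps_antitone f (Nat.le_mul_of_pos_left e hb) h1)

end thresholds

end BSRoot

theorem mainTheorem11 (p : ℕ) [Fact p.Prime] (R : Type*) [CommRing R] [IsDomain R] [CharP R p]
    (hfin : BSRoot.FFinite p R) (hreg : BSRoot.StronglyFRegular p R)
    (f : R) (hf : f ∈ nonZeroDivisors R) (hadm : BSRoot.IsBSAdmissible p (Ideal.span {f}))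
    (α : ℚ) (hα : ¬ p ∣ α.den) (hα₁ : -1 ≤ α) (hα₀ : α < 0) :
    List.TFAE
      [¬ IsSimpleModule (BSRoot.diffOp p R)
          (BSRoot.TwistedLocalization f (BSRoot.ratToPadicInt p α hα)),
        BSRoot.IsBSRoot p (Ideal.span {f}) (BSRoot.ratToPadicInt p α hα),
        BSRoot.IsDiffThreshold p (Ideal.span {f}) (-(α : ℝ))] := by
  have hf0 : f ≠ 0 := nonZeroDivisors.ne_zero hf
  tfae_have 1 → 2 := BSRoot.isBSRoot_of_not_isSimpleModule hreg hf0 hadm hα hα₁ hα₀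
  tfae_have 2 → 1 := BSRoot.not_isSimpleModule_of_isBSRoot hf0
  tfae_have 2 → 3 := BSRoot.IsBSRoot.isDiffThreshold hreg hf0 hα hα₁ hα₀
  tfae_have 3 → 2 := BSRoot.IsDiffThreshold.isBSRoot hreg hf0 hα hα₁ hα₀
  tfae_finish
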